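/- All graphs are finite, simple and undirected. Let $n \ge 4$ and let $P_n$ be the path of order $n$ (i.e. on $n$ vertices). The $P_n$-line graph $HL(G)$ of a graph $G$ is the graph whose vertices are the edges of $G$, two distinct edges being adjacent in $HL(G)$ if they share an endpoint in $G$ and lie in a common subgraph of $G$ isomorphic to $P_n$. Put $HL^0(G)=G$ and $HL^{k+1}(G)=HL(HL^k(G))$. The sequence $\{HL^k(G)\}$ converges if $HL^N(G)\cong HL^{N+1}(G)$ for some $N\ge 0$ such that $HL^N(G)$ is not the empty graph (a sequence that reaches the empty graph terminates, and is not called convergent). Let $\Lambda_n$ be the set of graphs $G$ whose sequence converges, and let $\lambda_n$ be the set of those $G\in\Lambda_n$ none of whose proper subgraphs is in $\Lambda_n$. For $m\ge 3$ and $r\ge 1$ let $G^r_m$ be the graph of order $m+r$ that consists of a cycle of size $m$ and a disjoint path of order $r$, with one vertex of the cycle joined by an edge to an end vertex of the path, and let $\delta_n$ be the set of graphs isomorphic to some $G^r_m$ with $r+m=n$. A path in $G$ is non-extendable if it cannot be prolonged to a longer path by adding an edge of $G$ at either of its ends. A vertex is pendant in $G$ if it has degree $1$ in $G$. Lemma.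 Let $G\in\lambda_n$, and assume that $G\notin\delta_n$ and that $G$ is not a cycle. Let $P$ be a non-extendable path in $G$ of order at least $n$, with endpoints $p_1$ and $p_2$. Then $p_1$ and $p_2$ are pendant vertices of $G$. -/

import Mathlib

universe u v

namespace HLine

/-- The `H`-line graph of `G`: its vertices are the edges of `G`, and two distinct edges are
adjacent when they share an endpoint and both lie in one subgraph of `G` isomorphic to `H`. -/
def hLineGraph {W : Type v} {V : Type u} (H : SimpleGraph W) (G : SimpleGraph V) :
    SimpleGraph G.edgeSet where
  Adj e f := e ≠ f ∧ (∃ x : V, x ∈ (e : Sym2 V) ∧ x ∈ (f : Sym2 V)) ∧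
    ∃ S : G.Subgraph, Nonempty (H ≃g S.coe) ∧
      (e : Sym2 V) ∈ S.edgeSet ∧ (f : Sym2 V) ∈ S.edgeSet
  symm := ⟨by
    rintro e f ⟨hne, ⟨x, hxe, hxf⟩, S, hS, he, hf⟩
    exact ⟨hne.symm, ⟨x, hxf, hxe⟩, S, hS, hf, he⟩⟩
  loopless := ⟨fun _ h => h.1 rfl⟩

/-- The `k`-th iterated `H`-line graph of `G`, together with its vertex type. -/
def hLineIter {W : Type v} {V : Type u} (H : SimpleGraph W) (G : SimpleGraph V) :
    ℕ → (Σ X : Type u, SimpleGraph X)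
  | 0 => ⟨V, G⟩
  | k + 1 => ⟨(hLineIter H G k).2.edgeSet, hLineGraph H (hLineIter H G k).2⟩

/-- The sequence of iterated `P_n`-line graphs of `G` converges, i.e. two consecutive terms are
isomorphic. The term must have a vertex: a sequence that reaches the empty graph terminates and
does not count as convergent. (A graph with vertices but without edges is never isomorphic to its
`P_n`-line graph, which has no vertices.) -/
def IsConvergent {V : Type u} (n : ℕ) (G : SimpleGraph V) : Prop :=
  ∃ N : ℕ, Nonempty (hLineIter (SimpleGraph.pathGraph n) G N).1 ∧
    Nonempty ((hLineIter (SimpleGraph.pathGraph n) G N).2 ≃g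
      (hLineIter (SimpleGraph.pathGraph n) G (N + 1)).2)

/-- `G` is minimally `n`-convergent: it is convergent and no proper subgraph is. -/
def IsMinimallyConvergent {V : Type u} (n : ℕ) (G : SimpleGraph V) : Prop :=
  IsConvergent n G ∧ ∀ S : G.Subgraph, S ≠ ⊤ → ¬ IsConvergent n S.coe

/-- The graph of order `m + r` made of a cycle of size `m` and a disjoint path of order `r`, one
vertex of the cycle being joined by an edge to an end vertex of the path (used for `3 ≤ m` and
`1 ≤ r`). -/
def tadpole (m r : ℕ) : SimpleGraph (Fin m ⊕ Fin r) where
  Adj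
    | .inl a, .inl b => (SimpleGraph.cycleGraph m).Adj a b
    | .inr a, .inr b => (SimpleGraph.pathGraph r).Adj a b
    | .inl a, .inr b => (a : ℕ) = 0 ∧ (b : ℕ) = 0
    | .inr b, .inl a => (a : ℕ) = 0 ∧ (b : ℕ) = 0
  symm := ⟨by
    rintro (a | a) (b | b) h
    · exact SimpleGraph.Adj.symm h
    · exact h
    · exact h
    · exact SimpleGraph.Adj.symm h⟩
  loopless := ⟨by
    rintro (a | a) h
    · exact SimpleGraph.irrefl _ h
    · exact SimpleGraph.irrefl _ h⟩

/-- `G` belongs, up to isomorphism, to the family of tadpoles of order `n`. -/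
def IsDelta {V : Type u} (n : ℕ) (G : SimpleGraph V) : Prop :=
  ∃ m r : ℕ, 3 ≤ m ∧ 1 ≤ r ∧ r + m = n ∧ Nonempty (G ≃g tadpole m r)

/-- `G` is a cycle. -/
def IsCycle {V : Type u} (G : SimpleGraph V) : Prop :=
  ∃ m : ℕ, 3 ≤ m ∧ Nonempty (G ≃g SimpleGraph.cycleGraph m)

/-- A path that cannot be prolonged to a longer path by an edge at either of its ends. -/
def IsNonExtendablePath {V : Type u} {G : SimpleGraph V} {x y : V} (p : G.Walk x y) : Prop :=
  p.IsPath ∧ (∀ (w : V) (h : G.Adj w x), ¬ (SimpleGraph.Walk.cons h p).IsPath) ∧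
    ∀ (w : V) (h : G.Adj y w), ¬ (p.concat h).IsPath

end HLine

namespace HLine

open SimpleGraph

/-! ### Invariance of `H`-line graphs and of convergence -/

section General

universe w

variable {W : Type w} {V : Type u} {V' : Type v} {H : SimpleGraph W}
  {G : SimpleGraph V} {G' : SimpleGraph V'}

/-! Suppose `p₁` has a neighbour `w` other than its successor on `P`. Non-extendability puts `w` on
`P`, so the chord closes a cycle on an initial segment of `m` vertices. If `m ≥ n`, this cycle is
isomorphic to its own `P_n`-line graph, hence convergent. If `m < n`, the first `n` vertices of `P`
with the chord form `lollipop n m`, a tadpole; its `P_n`-line graph is `lollipop n (m + 1)`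
(`nonempty_lollipop_iso_hLineGraph`), so iteration ends at the cycle `lollipop n n`. By minimality
`G` is that cycle or tadpole, and both are excluded. Reversing `P` handles `p₂`. -/

theorem hLineGraph_adj_iff {e f : G.edgeSet} :
    (hLineGraph H G).Adj e f ↔ e ≠ f ∧ (∃ x : V, x ∈ (e : Sym2 V) ∧ x ∈ (f : Sym2 V)) ∧
      ∃ φ : H.Copy G, (∃ a ∈ H.edgeSet, Sym2.map φ a = e) ∧ ∃ b ∈ H.edgeSet, Sym2.map φ b = f := by
  refine and_congr Iff.rfl (and_congr Iff.rfl ⟨?_, ?_⟩)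
  · rintro ⟨S, hS, he, hf⟩
    obtain ⟨φ, rfl⟩ : S ∈ Set.range (Copy.toSubgraph (A := H) (B := G)) := by
      rw [Copy.range_toSubgraph]; exact hS
    refine ⟨φ, ?_⟩
    rw [Subgraph.edgeSet_map, Subgraph.edgeSet_top] at he hf
    exact ⟨he, hf⟩
  · rintro ⟨φ, he, hf⟩
    refine ⟨φ.toSubgraph, ⟨φ.isoToSubgraph⟩, ?_⟩
    rw [Subgraph.edgeSet_map, Subgraph.edgeSet_top]
    exact ⟨he, hf⟩

theorem hLineGraph_adj_map (g : G ≃g G') {e f : G.edgeSet} (h : (hLineGraph H G).Adj e f) :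
    (hLineGraph H G').Adj (g.mapEdgeSet e) (g.mapEdgeSet f) := by
  rw [hLineGraph_adj_iff] at h ⊢
  obtain ⟨hne, ⟨x, hxe, hxf⟩, φ, ⟨a, ha, hae⟩, b, hb, hbf⟩ := h
  refine ⟨fun h => hne (g.mapEdgeSet.injective h),
    ⟨g x, Sym2.mem_map.2 ⟨x, hxe, rfl⟩, Sym2.mem_map.2 ⟨x, hxf, rfl⟩⟩,
    g.toCopy.comp φ, ⟨a, ha, ?_⟩, b, hb, ?_⟩
  · change _ = Sym2.map g e
    rw [← hae, Sym2.map_map]; rfl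
  · change _ = Sym2.map g f
    rw [← hbf, Sym2.map_map]; rfl

/-- Isomorphic graphs have isomorphic `H`-line graphs. -/
def hLineGraphIso (g : G ≃g G') : hLineGraph H G ≃g hLineGraph H G' where
  toEquiv := g.mapEdgeSet
  map_rel_iff' {e f} := by
    refine ⟨fun h => ?_, hLineGraph_adj_map g⟩
    have := hLineGraph_adj_map g.symm h
    rwa [show g.symm.mapEdgeSet (g.mapEdgeSet e) = e from g.mapEdgeSet.symm_apply_apply e,
      show g.symm.mapEdgeSet (g.mapEdgeSet f) = f from g.mapEdgeSet.symm_apply_apply f] at this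

theorem nonempty_hLineIter_iso (g : G ≃g G') (k : ℕ) :
    Nonempty ((hLineIter H G k).2 ≃g (hLineIter H G' k).2) := by
  induction k with
  | zero => exact ⟨g⟩
  | succ k ih => exact ih.map hLineGraphIso

theorem hLineIter_hLineGraph (k : ℕ) :
    hLineIter H (hLineGraph H G) k = hLineIter H G (k + 1) := by
  induction k with
  | zero => rfl
  | succ k ih =>
    exact congrArg (fun X : (Σ X : Type u, SimpleGraph X) =>
      (⟨X.2.edgeSet, hLineGraph H X.2⟩ : Σ X : Type u, SimpleGraph X)) ih

theorem IsConvergent.of_iso {n : ℕ} (g : G ≃g G') (h : IsConvergent n G) : IsConvergent n G' := by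
  obtain ⟨N, hne, ⟨i⟩⟩ := h
  obtain ⟨a⟩ := nonempty_hLineIter_iso (H := pathGraph n) g N
  obtain ⟨b⟩ := nonempty_hLineIter_iso (H := pathGraph n) g (N + 1)
  exact ⟨N, hne.map a, ⟨(a.symm.trans i).trans b⟩⟩

theorem IsConvergent.of_hLineGraph {n : ℕ} (h : IsConvergent n (hLineGraph (pathGraph n) G)) :
    IsConvergent n G := by
  obtain ⟨N, hne, hi⟩ := h
  rw [hLineIter_hLineGraph] at hne
  rw [hLineIter_hLineGraph, hLineIter_hLineGraph] at hi
  exact ⟨N + 1, hne, hi⟩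

theorem hLineGraph_adj_of_copy {n : ℕ} (φ : (pathGraph n).Copy G) {e f : G.edgeSet} {i : ℕ}
    (hi : i + 2 < n) (he : (e : Sym2 V) = s(φ ⟨i, by lia⟩, φ ⟨i + 1, by lia⟩))
    (hf : (f : Sym2 V) = s(φ ⟨i + 1, by lia⟩, φ ⟨i + 2, hi⟩)) :
    (hLineGraph (pathGraph n) G).Adj e f := by
  refine hLineGraph_adj_iff.2 ⟨?_, ⟨φ ⟨i + 1, by lia⟩, by simp [he], by simp [hf]⟩, φ,
    ⟨s(⟨i, by lia⟩, ⟨i + 1, by lia⟩), ?_, he.symm⟩,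
    s(⟨i + 1, by lia⟩, ⟨i + 2, hi⟩), ?_, hf.symm⟩
  · intro h
    rw [Subtype.ext_iff, he, hf, Sym2.eq_iff] at h
    rcases h with h | h
    · have := φ.injective h.1
      simp at this
    · have := φ.injective h.1
      simp at this
  · simp [pathGraph_adj]
  · simp [pathGraph_adj]

end General

/-! ### Path-line graphs of lollipops and cycles -/

/-- The path `0, 1, …, N - 1` together with an edge joining `0` to `m - 1`. -/
def lollipop (N m : ℕ) : SimpleGraph (Fin N) where
  Adj i j := i ≠ j ∧ ((i : ℕ) + 1 = j ∨ (j : ℕ) + 1 = i ∨ ((i : ℕ) = 0 ∧ (j : ℕ) + 1 = m) ∨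
    ((j : ℕ) = 0 ∧ (i : ℕ) + 1 = m))
  symm := ⟨by rintro i j ⟨h, h'⟩; exact ⟨h.symm, by lia⟩⟩
  loopless := ⟨fun _ h => h.1 rfl⟩

variable {N m n : ℕ}

theorem lollipop_adj {i j : Fin N} : (lollipop N m).Adj i j ↔ i ≠ j ∧ ((i : ℕ) + 1 = j ∨
    (j : ℕ) + 1 = i ∨ ((i : ℕ) = 0 ∧ (j : ℕ) + 1 = m) ∨ ((j : ℕ) = 0 ∧ (i : ℕ) + 1 = m)) := Iff.rfl

/-- The edges of a lollipop, enumerated so that the chord comes first. -/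
def lollipopEdge (hm : 3 ≤ m) (hmN : m ≤ N) (i : Fin N) : (lollipop N m).edgeSet :=
  -- Truncated subtraction makes the first endpoint `0` when `i = 0`, as the chord requires.
  ⟨s(⟨(i : ℕ) - 1, by lia⟩, if (i : ℕ) = 0 then ⟨m - 1, by lia⟩ else i), by
    rw [mem_edgeSet, lollipop_adj, Ne, Fin.ext_iff]
    split_ifs <;> simp <;> lia⟩

theorem lollipopEdge_eq_iff (hm : 3 ≤ m) (hmN : m ≤ N) (i a b : Fin N) :
    (lollipopEdge hm hmN i : Sym2 (Fin N)) = s(a, b) ↔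
      ((i : ℕ) = 0 ∧ ((a : ℕ) = 0 ∧ (b : ℕ) + 1 = m ∨ (b : ℕ) = 0 ∧ (a : ℕ) + 1 = m)) ∨
      ((i : ℕ) ≠ 0 ∧ ((a : ℕ) + 1 = i ∧ b = i ∨ (b : ℕ) + 1 = i ∧ a = i)) := by
  simp only [lollipopEdge, Sym2.eq_iff, Fin.ext_iff]
  split_ifs with h <;> lia

theorem mem_lollipopEdge_iff (hm : 3 ≤ m) (hmN : m ≤ N) (i a : Fin N) :
    a ∈ (lollipopEdge hm hmN i : Sym2 (Fin N)) ↔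
      (i : ℕ) = a ∨ (i : ℕ) = a + 1 ∨ ((i : ℕ) = 0 ∧ (a : ℕ) + 1 = m) := by
  simp only [lollipopEdge, Sym2.mem_iff, Fin.ext_iff]
  split_ifs with h <;> lia

theorem lollipopEdge_bijective (hm : 3 ≤ m) (hmN : m ≤ N) :
    Function.Bijective (lollipopEdge hm hmN) := by
  constructor
  · intro i j h
    have h' := congrArg Subtype.val h
    conv_rhs at h' => rw [lollipopEdge]
    rw [lollipopEdge_eq_iff] at h'
    simp only [Fin.ext_iff] at h' ⊢
    split_ifs at h' <;> simp at h' <;> lia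
  · rintro ⟨e, he⟩
    induction e using Sym2.ind with
    | _ a b =>
      rw [mem_edgeSet, lollipop_adj] at he
      obtain ⟨hne, h | h | h | h⟩ := he
      · exact ⟨b, Subtype.ext ((lollipopEdge_eq_iff ..).2 (by lia))⟩
      · exact ⟨a, Subtype.ext ((lollipopEdge_eq_iff ..).2 (by lia))⟩
      · exact ⟨⟨0, by lia⟩, Subtype.ext ((lollipopEdge_eq_iff ..).2 (by simp; lia))⟩
      · exact ⟨⟨0, by lia⟩, Subtype.ext ((lollipopEdge_eq_iff ..).2 (by simp; lia))⟩

/-- A map of path vertices given on naturals, as a copy of the path in a lollipop. -/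
def pathCopy (f : ℕ → ℕ) (hf : ∀ i < n, f i < N) (hinj : ∀ i < n, ∀ j < n, f i = f j → i = j)
    (hadj : ∀ i, i + 1 < n → f i + 1 = f (i + 1) ∨ f (i + 1) + 1 = f i ∨
      (f i = 0 ∧ f (i + 1) + 1 = m) ∨ (f (i + 1) = 0 ∧ f i + 1 = m)) :
    (pathGraph n).Copy (lollipop N m) where
  toHom :=
    { toFun := fun i => ⟨f i, hf i i.2⟩
      map_rel' := by
        intro i j h
        have hne := h.ne
        rw [pathGraph_adj] at h
        refine lollipop_adj.2 ⟨fun h' => hne ?_, ?_⟩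
        · rw [Fin.ext_iff] at h' ⊢
          exact hinj _ i.2 _ j.2 h'
        · rcases h with h | h
          · have := hadj i (by lia)
            rw [h] at this
            exact this
          · have := hadj j (by lia)
            rw [h] at this
            simp only []
            lia }
  injective' := by
    intro i j h
    rw [Fin.ext_iff]
    exact hinj _ i.2 _ j.2 (Fin.ext_iff.1 h)

theorem pathCopy_apply (f : ℕ → ℕ) (hf : ∀ i < n, f i < N)
    (hinj : ∀ i < n, ∀ j < n, f i = f j → i = j)
    (hadj : ∀ i, i + 1 < n → f i + 1 = f (i + 1) ∨ f (i + 1) + 1 = f i ∨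
      (f i = 0 ∧ f (i + 1) + 1 = m) ∨ (f (i + 1) = 0 ∧ f i + 1 = m)) (i : Fin n) :
    (pathCopy f hf hinj hadj i : ℕ) = f i := rfl

/-- Consecutive edges of the path of a lollipop are adjacent in its path-line graph. -/
theorem hLineGraph_lollipop_adj_path (hm : 3 ≤ m) (hmN : m ≤ N) (hn : 3 ≤ n) (hnN : n ≤ N)
    {i j : Fin N} (hi : (i : ℕ) ≠ 0) (hj : (i : ℕ) + 1 = j) :
    (hLineGraph (pathGraph n) (lollipop N m)).Adj (lollipopEdge hm hmN i)
      (lollipopEdge hm hmN j) := by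
  -- A window of `n` consecutive vertices, starting at `s`, that contains `i - 1`, `i`, `i + 1`.
  obtain ⟨s, t, hs, hst, ht⟩ : ∃ s t : ℕ, s + n ≤ N ∧ s + t + 1 = i ∧ t + 2 < n := by
    rcases le_total ((i : ℕ) - 1) (N - n) with h | h
    · exact ⟨i - 1, 0, by lia⟩
    · exact ⟨N - n, i - 1 - (N - n), by lia⟩
  refine hLineGraph_adj_of_copy (pathCopy (fun k => s + k) (by lia) (by lia) (by lia)) ht ?_ ?_ <;>
  · rw [lollipopEdge_eq_iff]
    simp only [Fin.ext_iff, pathCopy_apply]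
    lia

theorem hLineGraph_lollipop_adj_first (hm : 3 ≤ m) (hmN : m ≤ N) (hn : 3 ≤ n)
    (h : n = N ∨ n ≤ m ∧ m = N) {i j : Fin N} (hi : (i : ℕ) = 0) (hj : (j : ℕ) = 1) :
    (hLineGraph (pathGraph n) (lollipop N m)).Adj (lollipopEdge hm hmN i)
      (lollipopEdge hm hmN j) := by
  rcases hmN.lt_or_eq with hlt | rfl
  -- Here `n = N`: the Hamiltonian path `m - 2, …, 1, 0, m - 1, m, …, N - 1` uses the chord after
  -- the edge `{1, 0}`.
  · refine (hLineGraph_adj_of_copy (i := m - 3)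
      (pathCopy (fun k => if k + 2 ≤ m then m - 2 - k else k) ?_ ?_ ?_) (by lia) ?_ ?_).symm
    · intro i _; split_ifs <;> lia
    · intro i _ j _; split_ifs <;> lia
    · intro i _; split_ifs <;> lia
    all_goals
      rw [lollipopEdge_eq_iff]
      simp only [Fin.ext_iff, pathCopy_apply]
      split_ifs <;> lia
  · refine hLineGraph_adj_of_copy (i := 0)
      (pathCopy (fun k => if k = 0 then m - 1 else k - 1) ?_ ?_ ?_) (by lia) ?_ ?_
    · intro i _; split_ifs <;> lia
    · intro i _ j _; split_ifs <;> lia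
    · intro i _; split_ifs <;> lia
    all_goals
      rw [lollipopEdge_eq_iff]
      simp only [Fin.ext_iff, pathCopy_apply]
      simp
      try lia

theorem hLineGraph_lollipop_adj_chord (hm : 3 ≤ m) (hmN : m < N) {i j : Fin N} (hi : (i : ℕ) = 0)
    (hj : (j : ℕ) = m) :
    (hLineGraph (pathGraph N) (lollipop N m)).Adj (lollipopEdge hm hmN.le i)
      (lollipopEdge hm hmN.le j) := by
  refine hLineGraph_adj_of_copy (i := m - 2)
    (pathCopy (fun k => if k + 2 ≤ m then m - 2 - k else k) ?_ ?_ ?_) (by lia) ?_ ?_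
  · intro i _; split_ifs <;> lia
  · intro i _ j _; split_ifs <;> lia
  · intro i _; split_ifs <;> lia
  all_goals
    rw [lollipopEdge_eq_iff]
    simp only [Fin.ext_iff, pathCopy_apply]
    split_ifs <;> lia

theorem hLineGraph_lollipop_adj_last (hm : 3 ≤ m) (hn : 3 ≤ n) (hnm : n ≤ m) {i j : Fin m}
    (hi : (i : ℕ) = 0) (hj : (j : ℕ) + 1 = m) :
    (hLineGraph (pathGraph n) (lollipop m m)).Adj (lollipopEdge hm le_rfl i)
      (lollipopEdge hm le_rfl j) := by
  -- The path runs backwards round the cycle: `0, m - 1, m - 2, …`.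
  refine hLineGraph_adj_of_copy (i := 0)
    (pathCopy (fun k => if k = 0 then 0 else m - k) ?_ ?_ ?_) (by lia) ?_ ?_
  · intro i _; split_ifs <;> lia
  · intro i _ j _; split_ifs <;> lia
  · intro i _; split_ifs <;> lia
  all_goals
    rw [lollipopEdge_eq_iff]
    simp only [Fin.ext_iff, pathCopy_apply]
    simp
    try lia

/-- A Hamiltonian path of a lollipop cannot use both cycle edges at the vertex of degree three. -/
theorem not_hLineGraph_lollipop_adj (hm : 3 ≤ m) (hmN : m < N) {i j : Fin N} (hi : (i : ℕ) = 0)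
    (hj : (j : ℕ) + 1 = m) :
    ¬ (hLineGraph (pathGraph N) (lollipop N m)).Adj (lollipopEdge hm hmN.le i)
      (lollipopEdge hm hmN.le j) := by
  intro h
  obtain ⟨-, -, φ, ⟨a, ha, hae⟩, b, hb, hbf⟩ := hLineGraph_adj_iff.1 h
  induction a using Sym2.ind with | _ a₁ a₂ =>
  induction b using Sym2.ind with | _ b₁ b₂ =>
  rw [mem_edgeSet, pathGraph_adj] at ha hb
  rw [Sym2.map_mk, eq_comm, lollipopEdge_eq_iff] at hae hbf
  have hinj : ∀ x y, (φ x : ℕ) = φ y → (x : ℕ) = y := fun x y h =>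
    congrArg _ (φ.injective (Fin.ext h))
  have hsurj : Function.Surjective φ := Finite.injective_iff_surjective.1 φ.injective
  obtain ⟨c, hc⟩ := hsurj ⟨m - 1, by lia⟩
  obtain ⟨p, hp⟩ := hsurj ⟨0, by lia⟩
  obtain ⟨q, hq⟩ := hsurj ⟨m - 2, by lia⟩
  obtain ⟨z, hz⟩ := hsurj ⟨m, hmN⟩
  rw [Fin.ext_iff] at hc hp hq hz
  simp only [Fin.ext_iff] at hc hp hq hz hae hbf
  have hcp : (c : ℕ) + 1 = p ∨ (p : ℕ) + 1 = c := by
    have := hinj a₁ c; have := hinj a₁ p; have := hinj a₂ c; have := hinj a₂ p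
    lia
  have hcq : (c : ℕ) + 1 = q ∨ (q : ℕ) + 1 = c := by
    have := hinj b₁ c; have := hinj b₁ q; have := hinj b₂ c; have := hinj b₂ q
    lia
  have hpq : (p : ℕ) ≠ q := by
    intro h
    have : p = q := Fin.ext h
    subst this
    lia
  -- The only edge from the cycle to the tail is `{m - 1, m}`, but both path neighbours of `m - 1`
  -- are already the cycle vertices `0` and `m - 2`. The path could then never reach `m`.
  have hstep : ∀ x y : Fin N, (pathGraph N).Adj x y → (φ x : ℕ) < m → (φ y : ℕ) < m := by
    intro x y hxy hx
    by_contra hy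
    have h' := (lollipop_adj.1 (φ.toHom.map_adj hxy)).2
    simp only [Copy.toHom_apply] at h'
    rw [pathGraph_adj] at hxy
    have hxc := hinj x c (by lia)
    have hyz := hinj y z (by lia)
    have : (y : ℕ) = p ∨ (y : ℕ) = q := by lia
    rcases this with h | h
    · rw [Fin.ext h] at hy; lia
    · rw [Fin.ext h] at hy; lia
  have hreach : ∀ {x y : Fin N}, (pathGraph N).Walk x y → (φ x : ℕ) < m → (φ y : ℕ) < m := by
    intro x y w
    induction w with
    | nil => exact id
    | cons h _ ih => exact fun hx => ih (hstep _ _ h hx)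
  obtain ⟨w⟩ := pathGraph_preconnected N p z
  have := hreach w (by lia)
  lia

theorem eq_of_hLineGraph_lollipop_adj (hm : 3 ≤ m) (hmN : m ≤ N) {i j : Fin N}
    (h : (hLineGraph (pathGraph n) (lollipop N m)).Adj (lollipopEdge hm hmN i)
      (lollipopEdge hm hmN j)) :
    i ≠ j ∧ ((i : ℕ) + 1 = j ∨ (j : ℕ) + 1 = i ∨
      ((i : ℕ) = 0 ∧ ((j : ℕ) + 1 = m ∨ (j : ℕ) = m)) ∨
      ((j : ℕ) = 0 ∧ ((i : ℕ) + 1 = m ∨ (i : ℕ) = m))) := by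
  refine ⟨fun hij => h.ne (congrArg _ hij), ?_⟩
  obtain ⟨hne, ⟨x, hx, hx'⟩, -⟩ := h
  have hne : (i : ℕ) ≠ j := fun h => hne (congrArg _ (Fin.ext h))
  rw [mem_lollipopEdge_iff] at hx hx'
  lia

/-- In the ordinary line graph the chord, edge `0`, meets edges `1`, `m - 1` and `m`. Only its
adjacency to `m - 1` is lost, which leaves the path `0, …, N - 1` with the chord `{0, m}`. -/
theorem nonempty_lollipop_iso_hLineGraph (hm : 3 ≤ m) (hmN : m < N) :
    Nonempty (lollipop N (m + 1) ≃g hLineGraph (pathGraph N) (lollipop N m)) := by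
  refine ⟨⟨Equiv.ofBijective _ (lollipopEdge_bijective hm hmN.le), ?_⟩⟩
  intro i j
  rw [Equiv.ofBijective_apply, Equiv.ofBijective_apply]
  have key : ∀ i j : Fin N, (i : ℕ) + 1 = j →
      (hLineGraph (pathGraph N) (lollipop N m)).Adj (lollipopEdge hm hmN.le i)
      (lollipopEdge hm hmN.le j) := by
    intro i j h
    by_cases hi : (i : ℕ) = 0
    · exact hLineGraph_lollipop_adj_first hm hmN.le (by lia) (.inl rfl) hi (by lia)
    · exact hLineGraph_lollipop_adj_path hm hmN.le (by lia) le_rfl hi h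
  constructor
  · intro h
    obtain ⟨hne, h'⟩ := eq_of_hLineGraph_lollipop_adj hm hmN.le h
    refine lollipop_adj.2 ⟨hne, ?_⟩
    have h1 := fun hi hj => not_hLineGraph_lollipop_adj hm hmN (i := i) (j := j) hi hj h
    have h2 := fun hi hj => not_hLineGraph_lollipop_adj hm hmN (i := j) (j := i) hi hj h.symm
    lia
  · rintro ⟨-, h | h | h | h⟩
    · exact key _ _ h
    · exact (key _ _ h).symm
    · exact hLineGraph_lollipop_adj_chord hm hmN h.1 (by lia)
    · exact (hLineGraph_lollipop_adj_chord hm hmN h.1 (by lia)).symm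

/-- Any two consecutive edges of the cycle lie on a path of order `n`, so nothing is lost from the
ordinary line graph. -/
theorem nonempty_cycle_iso_hLineGraph (hn : 3 ≤ n) (hnm : n ≤ m) :
    Nonempty (lollipop m m ≃g hLineGraph (pathGraph n) (lollipop m m)) := by
  have hm : 3 ≤ m := by lia
  refine ⟨⟨Equiv.ofBijective _ (lollipopEdge_bijective hm le_rfl), ?_⟩⟩
  intro i j
  rw [Equiv.ofBijective_apply, Equiv.ofBijective_apply]
  have key : ∀ i j : Fin m, (i : ℕ) + 1 = j →
      (hLineGraph (pathGraph n) (lollipop m m)).Adj (lollipopEdge hm le_rfl i)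
      (lollipopEdge hm le_rfl j) := by
    intro i j h
    by_cases hi : (i : ℕ) = 0
    · exact hLineGraph_lollipop_adj_first hm le_rfl hn (.inr ⟨hnm, rfl⟩) hi (by lia)
    · exact hLineGraph_lollipop_adj_path hm le_rfl hn hnm hi h
  constructor
  · intro h
    obtain ⟨hne, h'⟩ := eq_of_hLineGraph_lollipop_adj hm le_rfl h
    exact lollipop_adj.2 ⟨hne, by lia⟩
  · rintro ⟨-, h | h | h | h⟩
    · exact key _ _ h
    · exact (key _ _ h).symm
    · exact hLineGraph_lollipop_adj_last hm hn hnm h.1 h.2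
    · exact (hLineGraph_lollipop_adj_last hm hn hnm h.1 h.2).symm

/-! ### Convergence of lollipops, and their identification with cycles and tadpoles -/

theorem isConvergent_cycle (hn : 3 ≤ n) (hnm : n ≤ m) : IsConvergent n (lollipop m m) :=
  ⟨0, ⟨(⟨0, by lia⟩ : Fin m)⟩, nonempty_cycle_iso_hLineGraph hn hnm⟩

theorem isConvergent_lollipop (hm : 3 ≤ m) (hmn : m ≤ n) : IsConvergent n (lollipop n m) := by
  induction hmn using Nat.decreasingInduction with
  | self => exact isConvergent_cycle hm le_rfl
  | of_succ k hk ih =>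
    obtain ⟨g⟩ := nonempty_lollipop_iso_hLineGraph hm hk
    exact ((ih (by lia)).of_iso g).of_hLineGraph

theorem lollipop_eq_cycleGraph (hm : 3 ≤ m) : lollipop m m = cycleGraph m := by
  have key : ∀ u v : Fin m, ((u - v : Fin m) : ℕ) = 1 ↔
      (v : ℕ) + 1 = u ∨ ((u : ℕ) = 0 ∧ (v : ℕ) + 1 = m) := by
    intro u v
    rw [Fin.sub_def]
    simp only []
    rcases le_or_gt (v : ℕ) u with h | h
    · rw [show m - (v : ℕ) + u = (u - v) + m by lia, Nat.add_mod_right, Nat.mod_eq_of_lt (by lia)]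
      lia
    · rw [Nat.mod_eq_of_lt (by lia)]
      lia
  ext u v
  rw [cycleGraph_adj', key, key, lollipop_adj, Ne, Fin.ext_iff]
  lia

theorem nonempty_lollipop_iso_tadpole (hm : 3 ≤ m) {r : ℕ} :
    Nonempty (lollipop (m + r) m ≃g tadpole m r) := by
  let f : Fin m ⊕ Fin r → Fin (m + r) :=
    -- The cycle is reversed because the tail hangs at `0` in `tadpole` but at `m - 1` in
    -- `lollipop`.
    Sum.elim (fun a => ⟨m - 1 - a, by lia⟩) (fun b => ⟨m + b, by lia⟩)
  have hinj : Function.Injective f := by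
    rintro (a | a) (b | b) h <;> simp only [f, Sum.elim_inl, Sum.elim_inr, Fin.ext_iff] at h
    · exact congrArg _ (Fin.ext (by lia))
    · lia
    · lia
    · exact congrArg _ (Fin.ext (by lia))
  have hbij : Function.Bijective f := by
    rw [Fintype.bijective_iff_injective_and_card]
    exact ⟨hinj, by simp⟩
  refine ⟨Iso.symm ⟨Equiv.ofBijective f hbij, ?_⟩⟩
  rintro (a | a) (b | b) <;>
    rw [Equiv.ofBijective_apply, Equiv.ofBijective_apply, lollipop_adj, Ne, Fin.ext_iff] <;>
    simp only [f, Sum.elim_inl, Sum.elim_inr, tadpole]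
  · rw [← lollipop_eq_cycleGraph hm, lollipop_adj, Ne, Fin.ext_iff]
    lia
  · lia
  · lia
  · rw [pathGraph_adj]
    lia

/-! ### Minimality and the endpoints of a non-extendable path -/

theorem IsMinimallyConvergent.iso_of_copy {V : Type u} {G : SimpleGraph V}
    (hG : IsMinimallyConvergent n G) {W : Type v} {K : SimpleGraph W} (hK : IsConvergent n K)
    (φ : K.Copy G) : Nonempty (G ≃g K) := by
  have hS : IsConvergent n φ.toSubgraph.coe := hK.of_iso φ.isoToSubgraph
  have htop : φ.toSubgraph = ⊤ := by
    by_contra h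
    exact hG.2 _ h hS
  have i := φ.isoToSubgraph
  rw [htop] at i
  exact ⟨(i.trans Subgraph.topIso).symm⟩

/-- An initial segment of a path whose first vertex has a chord to it carries a lollipop. -/
theorem exists_lollipop_copy {V : Type u} {G : SimpleGraph V} {x y : V} {p : G.Walk x y}
    (hp : p.IsPath) (hN : N ≤ p.length + 1) (hm : 3 ≤ m)
    (hadj : G.Adj x (p.getVert (m - 1))) : Nonempty ((lollipop N m).Copy G) := by
  refine ⟨⟨⟨fun i : Fin N => p.getVert i, ?_⟩, ?_⟩⟩
  · rintro i j ⟨-, h | h | h | h⟩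
    · rw [← h]
      exact p.adj_getVert_succ (by lia)
    · rw [← h]
      exact (p.adj_getVert_succ (by lia)).symm
    · rw [h.1, show (j : ℕ) = m - 1 by lia, p.getVert_zero]
      exact hadj
    · rw [h.1, show (i : ℕ) = m - 1 by lia, p.getVert_zero]
      exact hadj.symm
  · intro i j h
    exact Fin.ext (hp.getVert_injOn (by simp; lia) (by simp; lia) h)

theorem IsMinimallyConvergent.degree_eq_one {V : Type u} [Fintype V] {G : SimpleGraph V}
    [DecidableRel G.Adj] (hn : 3 ≤ n) (hG : IsMinimallyConvergent n G) (hdelta : ¬ IsDelta n G)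
    (hcycle : ¬ IsCycle G) {x y : V} {p : G.Walk x y} (hp : p.IsPath)
    (hext : ∀ (w : V) (h : G.Adj w x), ¬ (Walk.cons h p).IsPath) (horder : n ≤ p.length + 1) :
    G.degree x = 1 := by
  rw [degree_eq_one_iff_existsUnique_adj]
  have hsnd : G.Adj x (p.getVert 1) := by
    have := p.adj_getVert_succ (i := 0) (by lia)
    rwa [p.getVert_zero] at this
  refine ⟨p.getVert 1, hsnd, fun w hw => ?_⟩
  by_contra hne
  have hmem : w ∈ p.support := by
    by_contra h
    exact hext w hw.symm (hp.cons h)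
  obtain ⟨i, rfl, hi⟩ := Walk.mem_support_iff_exists_getVert.1 hmem
  have h0 : i ≠ 0 := by
    rintro rfl
    rw [p.getVert_zero] at hw
    exact hw.ne rfl
  have h1 : i ≠ 1 := fun h => hne (by rw [h])
  -- The chord from `x` to the vertex at index `i` closes a cycle of order `i + 1`.
  rcases le_or_gt n (i + 1) with h | h
  · obtain ⟨φ⟩ := exists_lollipop_copy (N := i + 1) (m := i + 1) hp (by lia) (by lia) hw
    obtain ⟨g⟩ := hG.iso_of_copy (isConvergent_cycle hn h) φ
    rw [lollipop_eq_cycleGraph (by lia)] at g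
    exact hcycle ⟨i + 1, by lia, ⟨g⟩⟩
  · obtain ⟨r, rfl⟩ := Nat.exists_eq_add_of_lt h
    obtain ⟨φ⟩ := exists_lollipop_copy (m := i + 1) hp horder (by lia) hw
    obtain ⟨g⟩ := hG.iso_of_copy (isConvergent_lollipop (by lia) (by lia)) φ
    obtain ⟨t⟩ := nonempty_lollipop_iso_tadpole (m := i + 1) (by lia) (r := r + 1)
    exact hdelta ⟨i + 1, r + 1, by lia, by lia, by lia, ⟨g.trans t⟩⟩

end HLine

theorem mainTheorem7 {V : Type u} [Fintype V] (G : SimpleGraph V) [DecidableRel G.Adj]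
    (n : ℕ) (hn : 4 ≤ n)
    (hG : HLine.IsMinimallyConvergent n G)
    (hdelta : ¬ HLine.IsDelta n G)
    (hcycle : ¬ HLine.IsCycle G)
    (p₁ p₂ : V) (P : G.Walk p₁ p₂)
    (hP : HLine.IsNonExtendablePath P)
    (horder : n ≤ P.support.length) :
    G.degree p₁ = 1 ∧ G.degree p₂ = 1 := by
  rw [SimpleGraph.Walk.length_support] at horder
  obtain ⟨hpath, hl, hr⟩ := hP
  refine ⟨hG.degree_eq_one (by lia) hdelta hcycle hpath hl horder,
    hG.degree_eq_one (by lia) hdelta hcycle hpath.reverse ?_ (by simpa using horder)⟩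
  intro w h hw
  refine hr w h.symm ?_
  rw [← SimpleGraph.Walk.isPath_reverse_iff, SimpleGraph.Walk.reverse_concat]
  exact hw
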